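/- Let $d\ge 0$ be an integer, let $X_d$ denote either the space $C(\mathbb{R}^d)$ of continuous complex-valued functions on $\mathbb{R}^d$ or the space $\mathcal{D}'(\mathbb{R}^d)$ of complex-valued Schwartz distributions on $\mathbb{R}^d$. For $y,h\in\mathbb{R}^d$ and $m\in\mathbb{N}$, let $(\tau_yf)(x)=f(x+y)$ and $\Delta_h^mf=\sum_{k=0}^m\binom{m}{k}(-1)^{m-k}\tau_{kh}f$ for functions $f$, and let $(\tau_yT)\{\varphi\}=T\{\tau_{-y}\varphi\}$ and $(\Delta_h^mT)\{\varphi\}=T\{\Delta_{-h}^m\varphi\}$ for distributions $T$ and test functions $\varphi$. A continuous exponential polynomial on $\mathbb{R}^d$ is a function of the form $f(x)=\sum_{i=1}^n p_i(x)e^{\langle\lambda_i,x\rangle}$ with complex polynomials $p_i$ in $d$ variables and $\lambda_i\in\mathbb{C}^d$, where $\langle\lambda,x\rangle=\sum_j\lambda_jx_j$; a distribution is called a continuous exponential polynomial if it is of the form $\varphi\mapsto\int_{\mathbb{R}^d}\varphi f\,dx$ for such an $f$. Let $h_1,\dots,h_t\in\mathbb{R}^d$ be such that the subgroup $h_1\mathbb{Z}+\cdots+h_t\mathbb{Z}$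 is dense in $\mathbb{R}^d$, let $m_1,\dots,m_t$ be positive integers, and let $W$ and $H$ be finite-dimensional complex linear subspaces of $X_d$ such that $$\Delta_{h_k}^{m_k}(W)\subseteq H\quad\text{and}\quad \Delta_{h_k}^{m_k}(H)\subseteq H\qquad (k=1,\dots,t).$$ Then there exists a finite-dimensional subspace $Z$ of $X_d$ which is invariant under all translations ($\tau_y(Z)\subseteq Z$ for every $y\in\mathbb{R}^d$) and contains $W\cup H$. Consequently, every element of $W\cup H$ is a continuous exponential polynomial. -/

import Mathlib

open TopologicalSpace MeasureTheory
open scoped Distributions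

noncomputable section

/-- The Euclidean space `ℝ^d`. -/
abbrev Euc (d : ℕ) : Type := EuclideanSpace ℝ (Fin d)

/-- Real-valued smooth compactly supported test functions on `ℝ^d`, with the LF topology. -/
abbrev TestFun (d : ℕ) : Type := 𝓓((⊤ : Opens (Euc d)), ℝ)

/-- Complex-valued Schwartz distributions on `ℝ^d`. Mathlib tests distributions against real-valued
test functions; a complex-linear functional on complex test functions is determined by these. -/
abbrev Distr (d : ℕ) : Type := 𝓓'((⊤ : Opens (Euc d)), ℂ)

/-! ### Translations and forward differences of continuous functions -/

/-- The translation operator `(τ_y f)(x) = f (x + y)` on `C(ℝ^d)`. -/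
def translateFun {d : ℕ} (y : Euc d) : C(Euc d, ℂ) →ₗ[ℂ] C(Euc d, ℂ) where
  toFun f := ⟨fun x => f (x + y), by fun_prop⟩
  map_add' _ _ := rfl
  map_smul' _ _ := rfl

/-- The forward difference `Δ_h^m f = ∑_{k=0}^m (m choose k) (-1)^(m-k) τ_{kh} f` on `C(ℝ^d)`. -/
def diffFun {d : ℕ} (h : Euc d) (m : ℕ) : C(Euc d, ℂ) →ₗ[ℂ] C(Euc d, ℂ) :=
  ∑ k ∈ Finset.range (m + 1), ((m.choose k : ℂ) * (-1) ^ (m - k)) • translateFun (k • h)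

/-! ### Translations and forward differences of test functions -/

/-- The compact set `K - y`. -/
def shiftCompact {d : ℕ} (y : Euc d) (K : Compacts (Euc d)) : Compacts (Euc d) :=
  K.map (fun x => x - y) (by fun_prop)

theorem mem_shiftCompact {d : ℕ} {y : Euc d} {K : Compacts (Euc d)} {x : Euc d} :
    x ∈ shiftCompact y K ↔ x + y ∈ K := by
  rw [← SetLike.mem_coe, ← SetLike.mem_coe, shiftCompact, Compacts.coe_map]
  constructor
  · rintro ⟨z, hz, rfl⟩
    simpa using hz
  · intro hx
    exact ⟨x + y, hx, by simp⟩

/-- Translation by `y`, as a continuous linear map from the smooth functions supported in `K`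
to the smooth functions supported in `K - y`. -/
def translateSupportedIn {d : ℕ} (y : Euc d) (K : Compacts (Euc d)) :
    ContDiffMapSupportedIn (Euc d) ℝ ⊤ K →L[ℝ]
      ContDiffMapSupportedIn (Euc d) ℝ ⊤ (shiftCompact y K) :=
  ContDiffMapSupportedIn.mkCLM ℝ (fun f x => f (x + y))
    (fun _ _ _ => rfl) (fun _ _ _ => rfl)
    (fun f => f.contDiff.comp (contDiff_id.add contDiff_const))
    (fun f x hx => f.zero_on_compl (fun hxy => hx (mem_shiftCompact.2 hxy)))
    (fun i hi => ⟨{i}, 1, zero_le_one, fun f x _ => by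
      rw [iteratedFDeriv_comp_add_right, one_mul, Finset.sup_singleton]
      exact ContDiffMapSupportedIn.norm_iteratedFDeriv_apply_le_seminorm ℝ hi⟩)

/-- The translation operator `(τ_y φ)(x) = φ (x + y)` on test functions. -/
def translateTest {d : ℕ} (y : Euc d) : TestFun d →L[ℝ] TestFun d :=
  TestFunction.limitCLM ℝ
    (fun φ => ⟨fun x => φ (x + y), φ.contDiff.comp (contDiff_id.add contDiff_const),
      φ.hasCompactSupport.comp_homeomorph (Homeomorph.addRight y), fun _ _ => trivial⟩)
    (fun K _ => (TestFunction.ofSupportedInCLM ℝ (Ω := ⊤) (fun _ _ => trivial)).comp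
      (translateSupportedIn y K))
    (fun _ _ _ => rfl)

theorem translateTest_apply {d : ℕ} (y : Euc d) (φ : TestFun d) (x : Euc d) :
    translateTest y φ x = φ (x + y) := rfl

/-- The forward difference `Δ_h^m φ = ∑_{k=0}^m (m choose k) (-1)^(m-k) τ_{kh} φ`
on test functions. -/
def diffTest {d : ℕ} (h : Euc d) (m : ℕ) : TestFun d →L[ℝ] TestFun d :=
  ∑ k ∈ Finset.range (m + 1), ((m.choose k : ℝ) * (-1) ^ (m - k)) • translateTest (k • h)

/-! ### Translations and forward differences of distributions -/

/-- The transpose `T ↦ T ∘ A` of a continuous linear operator `A` on test functions. -/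
def transposeDistr {d : ℕ} (A : TestFun d →L[ℝ] TestFun d) : Distr d →ₗ[ℂ] Distr d where
  toFun T := A.precompCompactConvergenceCLM ℂ T
  map_add' _ _ := rfl
  map_smul' _ _ := rfl

theorem transposeDistr_apply {d : ℕ} (A : TestFun d →L[ℝ] TestFun d) (T : Distr d)
    (φ : TestFun d) : transposeDistr A T φ = T (A φ) := rfl

/-- The translation operator `(τ_y T){φ} = T{τ_{-y} φ}` on distributions. -/
def translateDistr {d : ℕ} (y : Euc d) : Distr d →ₗ[ℂ] Distr d :=
  transposeDistr (translateTest (-y))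

/-- The forward difference `(Δ_h^m T){φ} = T{Δ_{-h}^m φ}` on distributions. -/
def diffDistr {d : ℕ} (h : Euc d) (m : ℕ) : Distr d →ₗ[ℂ] Distr d :=
  transposeDistr (diffTest (-h) m)

/-! ### Exponential polynomials -/

/-- `f` is a continuous exponential polynomial on `ℝ^d`: a finite sum
`f(x) = ∑ i, p_i(x) exp(⟨λ_i, x⟩)` with complex polynomials `p_i` in `d` variables, `λ_i ∈ ℂ^d`
and `⟨λ, x⟩ = ∑ j, λ_j x_j`. -/
def IsExpPoly {d : ℕ} (f : Euc d → ℂ) : Prop :=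
  ∃ (n : ℕ) (p : Fin n → MvPolynomial (Fin d) ℂ) (l : Fin n → Fin d → ℂ),
    ∀ x : Euc d, f x = ∑ i, MvPolynomial.eval (fun j => (x j : ℂ)) (p i) *
      Complex.exp (∑ j, l i j * (x j : ℂ))

/-- The distribution `T` is a continuous exponential polynomial: it is given by integration
against such a function. -/
def IsExpPolyDistr {d : ℕ} (T : Distr d) : Prop :=
  ∃ f : Euc d → ℂ, IsExpPoly f ∧ ∀ φ : TestFun d, T φ = ∫ x, (φ x : ℂ) * f x

end

/-! By the binomial theorem `Δ_h^m = (τ_h - 1)^m`, so `W ⊔ H` is finite-dimensional and stable under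
the powers `S_k ^ m_k` of the commuting operators `S_k = τ_{h_k} - 1`. Replacing `V` by `V + S V + ⋯
+ S^(m-1) V`, for one `S = S_k` after another, gives a finite-dimensional `Z` stable under every
`τ_{h_k}` (`exists_finiteDimensional_map_le`). Injectivity of translations makes `Z` stable under
the group generated by the `h_k`, and weak continuity of orbits makes it stable under all of `ℝ^d`
(`map_le_of_dense`).

Now `ℝ^d` acts continuously on the finite-dimensional `Z`, so the action is a product of matrix
exponentials `exp(y_j B_j)`, and its matrix coefficients are exponential polynomials
(`isExpPoly_coeff`). For a function, `f y = (τ_y f) 0` is such a coefficient. A distribution has no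
value at `0`, so `T` is first smoothed: `∫ ψ(z) τ_z T dz` lies in `Z` and is integration against the
coefficient `z ↦ T(τ_{-z} ψ)`. These averages suffice, since a functional on `Z` that kills them all
also kills `T` (`isExpPolyDistr_of_mem`). -/

noncomputable section

/-! ### Finite-dimensional subspaces invariant under commuting operators -/

section Invariant

variable {X : Type*} [AddCommGroup X] [Module ℂ X]

/-- `S` moves each summand `S^i V` to the next, and the last one lands in `S^m V ≤ V`, the summand
`i = 0`. -/
theorem map_le_iSup_map_pow {S : Module.End ℂ X} {m : ℕ} {V : Submodule ℂ X}
    (hV : V.map (S ^ m) ≤ V) (hm : 0 < m) :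
    (⨆ i : Fin m, V.map (S ^ (i : ℕ))).map S ≤ ⨆ i : Fin m, V.map (S ^ (i : ℕ)) := by
  rw [Submodule.map_iSup]
  refine iSup_le fun i => ?_
  have hi : (V.map (S ^ (i : ℕ))).map S = V.map (S ^ ((i : ℕ) + 1)) := by
    rw [pow_succ', Module.End.mul_eq_comp, Submodule.map_comp]
  rw [hi]
  rcases Nat.lt_or_ge ((i : ℕ) + 1) m with h | h
  · exact le_iSup (fun i : Fin m => V.map (S ^ (i : ℕ))) ⟨(i : ℕ) + 1, h⟩
  · have : (i : ℕ) + 1 = m := le_antisymm i.2 h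
    rw [this]
    refine hV.trans ?_
    simpa [Module.End.one_eq_id] using le_iSup (fun i : Fin m => V.map (S ^ (i : ℕ))) ⟨0, hm⟩

/-- Enlarging `V` for one operator does not spoil stability under the operators commuting with it.
-/
theorem map_iSup_map_pow_le_of_commute {S R : Module.End ℂ X} (hSR : Commute R S) {m : ℕ}
    {V : Submodule ℂ X} (hV : V.map R ≤ V) :
    (⨆ i : Fin m, V.map (S ^ (i : ℕ))).map R ≤ ⨆ i : Fin m, V.map (S ^ (i : ℕ)) := by
  rw [Submodule.map_iSup]
  refine iSup_mono fun i => ?_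
  rw [← Submodule.map_comp, ← Module.End.mul_eq_comp, (hSR.pow_right _).eq,
    Module.End.mul_eq_comp, Submodule.map_comp]
  exact Submodule.map_mono hV

theorem exists_finiteDimensional_map_le {ι : Type*} [Fintype ι] (S : ι → Module.End ℂ X)
    (hS : ∀ k l, Commute (S k) (S l)) (m : ι → ℕ) (hm : ∀ k, 0 < m k)
    (V : Submodule ℂ X) [FiniteDimensional ℂ V] (hV : ∀ k, V.map (S k ^ m k) ≤ V) :
    ∃ V' : Submodule ℂ X, FiniteDimensional ℂ V' ∧ V ≤ V' ∧ ∀ k, V'.map (S k) ≤ V' := by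
  classical
  -- Stability under every power `S k ^ m k` is carried along, because the operators outside `s`
  -- still need it.
  suffices h : ∀ s : Finset ι, ∃ V' : Submodule ℂ X, FiniteDimensional ℂ V' ∧ V ≤ V' ∧
      (∀ k, V'.map (S k ^ m k) ≤ V') ∧ ∀ k ∈ s, V'.map (S k) ≤ V' by
    obtain ⟨V', h1, h2, -, h3⟩ := h Finset.univ
    exact ⟨V', h1, h2, fun k => h3 k (Finset.mem_univ k)⟩
  intro s
  induction s using Finset.induction_on with
  | empty => exact ⟨V, inferInstance, le_rfl, hV, by simp⟩
  | insert a s _ ih =>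
    obtain ⟨V', h1, h2, h3, h4⟩ := ih
    refine ⟨⨆ i : Fin (m a), V'.map (S a ^ (i : ℕ)), inferInstance, h2.trans ?_, fun k =>
      map_iSup_map_pow_le_of_commute ((hS k a).pow_left _) (h3 k), fun k hk => ?_⟩
    · simpa [Module.End.one_eq_id] using
        le_iSup (fun i : Fin (m a) => V'.map (S a ^ (i : ℕ))) ⟨0, hm a⟩
    · rcases Finset.mem_insert.1 hk with rfl | hk
      · exact map_le_iSup_map_pow (h3 _) (hm _)
      · exact map_iSup_map_pow_le_of_commute (hS k a) (h4 k hk)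

end Invariant

/-! ### Finite-dimensional subspaces invariant under a dense group of translations -/

/-- An additive action of `E` on a complex vector space `X` by linear operators, together with a
separating family of linear functionals along which all orbit maps are continuous. -/
structure IsWeaklyContinuousRep {E X I : Type*} [AddCommGroup E] [TopologicalSpace E]
    [AddCommGroup X] [Module ℂ X] (τ : E → Module.End ℂ X) (L : I → Module.Dual ℂ X) : Prop where
  zero : τ 0 = 1
  add : ∀ a b, τ (a + b) = τ a * τ b
  separating : ∀ x, (∀ i, L i x = 0) → x = 0
  continuous : ∀ i x, Continuous fun y => L i (τ y x)

namespace IsWeaklyContinuousRep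

variable {E X I : Type*} [AddCommGroup E] [TopologicalSpace E]
    [AddCommGroup X] [Module ℂ X] {τ : E → Module.End ℂ X} {L : I → Module.Dual ℂ X}

theorem commute (hτ : IsWeaklyContinuousRep τ L) (a b : E) : Commute (τ a) (τ b) := by
  rw [Commute, SemiconjBy, ← hτ.add, ← hτ.add, add_comm]

theorem nsmul (hτ : IsWeaklyContinuousRep τ L) (k : ℕ) (a : E) : τ (k • a) = τ a ^ k := by
  induction k with
  | zero => simp [hτ.zero]
  | succ k ih => rw [succ_nsmul, hτ.add, ih, pow_succ]

theorem neg_apply (hτ : IsWeaklyContinuousRep τ L) (a : E) (x : X) : τ (-a) (τ a x) = x := by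
  rw [← Module.End.mul_apply, ← hτ.add, neg_add_cancel, hτ.zero, Module.End.one_apply]

theorem sum_choose_smul (hτ : IsWeaklyContinuousRep τ L) (a : E) (m : ℕ) :
    ∑ k ∈ Finset.range (m + 1), ((m.choose k : ℂ) * (-1) ^ (m - k)) • τ (k • a) =
      (τ a - 1) ^ m := by
  rw [sub_eq_add_neg, (Commute.neg_one_right (τ a)).add_pow]
  refine Finset.sum_congr rfl fun k _ => ?_
  rw [hτ.nsmul]
  have h : (-1 : Module.End ℂ X) ^ (m - k) * (m.choose k : Module.End ℂ X) =
      algebraMap ℂ _ ((m.choose k : ℂ) * (-1) ^ (m - k)) := by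
    rw [map_mul, map_pow, map_neg, map_one, map_natCast]
    exact (Nat.cast_commute _ _).symm
  rw [mul_assoc, h, ← Algebra.commutes, ← Algebra.smul_def]

/-- Functionals of the separating family span the dual of any finite-dimensional subspace. -/
theorem span_restrict_eq_top (hτ : IsWeaklyContinuousRep τ L) (Z : Submodule ℂ X)
    [FiniteDimensional ℂ Z] :
    Submodule.span ℂ (Set.range fun i => (L i).domRestrict Z) = ⊤ := by
  -- Separation says that the common kernel in `Z` is zero; in finite dimension a space of
  -- functionals is the annihilator of its common kernel.
  have h : (Submodule.span ℂ (Set.range fun i => (L i).domRestrict Z)).dualCoannihilator = ⊥ := by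
    refine (Submodule.eq_bot_iff _).2 fun z hz => ?_
    rw [Submodule.mem_dualCoannihilator] at hz
    refine Subtype.ext (hτ.separating z fun i => ?_)
    exact hz _ (Submodule.subset_span ⟨i, rfl⟩)
  rw [← Subspace.dualCoannihilator_dualAnnihilator_eq
    (W := Submodule.span ℂ (Set.range fun i => (L i).domRestrict Z)), h,
    Submodule.dualAnnihilator_bot]

/-- Every functional on a finite-dimensional subspace extends to one on the whole space along which
all orbit maps are continuous. -/
theorem exists_extend_continuous (hτ : IsWeaklyContinuousRep τ L) (Z : Submodule ℂ X)
    [FiniteDimensional ℂ Z] (f : Module.Dual ℂ Z) :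
    ∃ g : Module.Dual ℂ X, (∀ z : Z, g z = f z) ∧ ∀ x, Continuous fun y => g (τ y x) := by
  have hf : f ∈ Submodule.span ℂ (Set.range fun i => (L i).domRestrict Z) := by
    rw [hτ.span_restrict_eq_top]; trivial
  induction hf using Submodule.span_induction with
  | mem f hf =>
    obtain ⟨i, rfl⟩ := hf
    exact ⟨L i, fun _ => rfl, hτ.continuous i⟩
  | zero => exact ⟨0, fun _ => rfl, fun x => continuous_const⟩
  | add f f' _ _ h h' =>
    obtain ⟨g, h1, h2⟩ := h
    obtain ⟨g', h1', h2'⟩ := h'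
    exact ⟨g + g', fun z => by simp [h1, h1'], fun x => (h2 x).add (h2' x)⟩
  | smul c f _ h =>
    obtain ⟨g, h1, h2⟩ := h
    exact ⟨c • g, fun z => by simp [h1], fun x => (h2 x).const_smul c⟩

theorem map_eq_of_map_le (hτ : IsWeaklyContinuousRep τ L) (V : Submodule ℂ X)
    [FiniteDimensional ℂ V] {a : E} (h : V.map (τ a) ≤ V) : V.map (τ a) = V := by
  refine Submodule.eq_of_le_of_finrank_eq h ?_
  have hinj : Function.Injective (τ a) := Function.LeftInverse.injective (hτ.neg_apply a)
  exact (V.equivMapOfInjective (τ a) hinj).finrank_eq.symm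

/-- Equality, obtained on generators by counting dimensions, passes to negatives, which an inclusion
would not. -/
theorem map_eq_of_mem_closure (hτ : IsWeaklyContinuousRep τ L) (V : Submodule ℂ X)
    [FiniteDimensional ℂ V] {s : Set E} (h : ∀ a ∈ s, V.map (τ a) ≤ V) {y : E}
    (hy : y ∈ AddSubgroup.closure s) : V.map (τ y) = V := by
  induction hy using AddSubgroup.closure_induction with
  | mem a ha => exact hτ.map_eq_of_map_le V (h a ha)
  | zero => rw [hτ.zero, Module.End.one_eq_id, Submodule.map_id]
  | add a b _ _ ha hb => rw [hτ.add, Module.End.mul_eq_comp, Submodule.map_comp, hb, ha]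
  | neg a _ ha =>
    nth_rw 1 [← ha]
    rw [← Submodule.map_comp, ← Module.End.mul_eq_comp, ← hτ.add, neg_add_cancel, hτ.zero,
      Module.End.one_eq_id, Submodule.map_id]

/-- If `τ y x ∉ V`, some functional vanishes on `V` but not at `τ y x`; along the orbit of `x` it is
continuous and zero on a dense subgroup, a contradiction. -/
theorem map_le_of_dense (hτ : IsWeaklyContinuousRep τ L) (V : Submodule ℂ X)
    [FiniteDimensional ℂ V] {s : Set E} (h : ∀ a ∈ s, V.map (τ a) ≤ V)
    (hs : Dense (AddSubgroup.closure s : Set E)) (y : E) : V.map (τ y) ≤ V := by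
  rintro _ ⟨x, hx, rfl⟩
  by_contra hxy
  obtain ⟨f, hf, hfV⟩ := Submodule.exists_le_ker_of_notMem hxy
  -- The subspace includes `τ y x`, so that `g` agrees with `f` there as well as on `V`.
  obtain ⟨g, hg, hgc⟩ := hτ.exists_extend_continuous (V ⊔ Submodule.span ℂ {τ y x})
    (f.domRestrict _)
  have hzero : (fun y => g (τ y x)) = fun _ => 0 := by
    refine Continuous.ext_on hs (hgc x) continuous_const fun z hz => ?_
    have hzV : τ z x ∈ V := by
      rw [← hτ.map_eq_of_mem_closure V h hz]
      exact Submodule.mem_map_of_mem hx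
    exact (hg ⟨τ z x, Submodule.mem_sup_left hzV⟩).trans (hfV hzV)
  refine hf ?_
  have := hg ⟨τ y x, Submodule.mem_sup_right (Submodule.mem_span_singleton_self _)⟩
  exact this.symm.trans (congrFun hzero y)

theorem exists_invariant (hτ : IsWeaklyContinuousRep τ L) {ι : Type*} [Fintype ι] (h : ι → E)
    (m : ι → ℕ) (hm : ∀ k, 0 < m k)
    (hdense : Dense (AddSubgroup.closure (Set.range h) : Set E))
    (W H : Submodule ℂ X) [FiniteDimensional ℂ W] [FiniteDimensional ℂ H]
    (hW : ∀ k, W.map ((τ (h k) - 1) ^ m k) ≤ H) (hH : ∀ k, H.map ((τ (h k) - 1) ^ m k) ≤ H) :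
    ∃ Z : Submodule ℂ X, FiniteDimensional ℂ Z ∧ (∀ y, Z.map (τ y) ≤ Z) ∧
      (W : Set X) ∪ (H : Set X) ⊆ (Z : Set X) := by
  obtain ⟨Z, hZ, hWHZ, hinv⟩ := exists_finiteDimensional_map_le (fun k => τ (h k) - 1)
    (fun k l => ((hτ.commute _ _).sub_left (Commute.one_left _)).sub_right (Commute.one_right _))
    m hm (W ⊔ H) (fun k => by
      rw [Submodule.map_sup]
      exact (sup_le (hW k) (hH k)).trans le_sup_right)
  refine ⟨Z, hZ, hτ.map_le_of_dense Z ?_ hdense, Set.union_subset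
    (fun x hx => hWHZ (Submodule.mem_sup_left hx)) fun x hx => hWHZ (Submodule.mem_sup_right hx)⟩
  rintro _ ⟨k, rfl⟩ _ ⟨x, hx, rfl⟩
  have := hinv k (Submodule.mem_map_of_mem hx)
  simpa using Z.add_mem this hx

end IsWeaklyContinuousRep

/-! ### The algebra of exponential polynomials -/

namespace IsExpPoly

variable {d : ℕ}

theorem of_fintype {ι : Type*} [Fintype ι] {f : Euc d → ℂ} (p : ι → MvPolynomial (Fin d) ℂ)
    (l : ι → Fin d → ℂ)
    (h : ∀ x : Euc d, f x = ∑ i, MvPolynomial.eval (fun j => (x j : ℂ)) (p i) *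
      Complex.exp (∑ j, l i j * (x j : ℂ))) : IsExpPoly f := by
  let e := Fintype.equivFin ι
  refine ⟨Fintype.card ι, fun i => p (e.symm i), fun i => l (e.symm i), fun x => ?_⟩
  rw [h x]
  exact (Equiv.sum_comp e.symm fun i => MvPolynomial.eval (fun j => (x j : ℂ)) (p i) *
      Complex.exp (∑ j, l i j * (x j : ℂ))).symm

theorem eval_mul_exp (p : MvPolynomial (Fin d) ℂ) (l : Fin d → ℂ) :
    IsExpPoly fun x : Euc d => MvPolynomial.eval (fun j => (x j : ℂ)) p *
      Complex.exp (∑ j, l j * (x j : ℂ)) :=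
  of_fintype (ι := Unit) (fun _ => p) (fun _ => l) fun x => by simp

theorem const (c : ℂ) : IsExpPoly fun _ : Euc d => c := by
  simpa using eval_mul_exp (d := d) (MvPolynomial.C c) 0

theorem coord (j : Fin d) : IsExpPoly fun x : Euc d => (x j : ℂ) := by
  simpa using eval_mul_exp (d := d) (MvPolynomial.X j) 0

theorem exp_coord (μ : ℂ) (j : Fin d) : IsExpPoly fun x : Euc d => Complex.exp (μ * (x j : ℂ)) := by
  simpa [Pi.single_apply] using eval_mul_exp (d := d) 1 (Pi.single j μ)

theorem add {f g : Euc d → ℂ} (hf : IsExpPoly f) (hg : IsExpPoly g) :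
    IsExpPoly fun x => f x + g x := by
  obtain ⟨n, p, l, h⟩ := hf
  obtain ⟨n', p', l', h'⟩ := hg
  exact of_fintype (Sum.elim p p') (Sum.elim l l') fun x => by simp [h, h']

theorem mul {f g : Euc d → ℂ} (hf : IsExpPoly f) (hg : IsExpPoly g) :
    IsExpPoly fun x => f x * g x := by
  obtain ⟨n, p, l, h⟩ := hf
  obtain ⟨n', p', l', h'⟩ := hg
  refine of_fintype (fun i : Fin n × Fin n' => p i.1 * p' i.2) (fun i => l i.1 + l' i.2)
    fun x => ?_
  rw [h, h', Finset.sum_mul_sum, Fintype.sum_prod_type]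
  refine Finset.sum_congr rfl fun i _ => Finset.sum_congr rfl fun j _ => ?_
  simp only [map_mul, Pi.add_apply, add_mul, Finset.sum_add_distrib, Complex.exp_add]
  ring

theorem sum {ι : Type*} (s : Finset ι) {f : ι → Euc d → ℂ} (hf : ∀ i ∈ s, IsExpPoly (f i)) :
    IsExpPoly fun x => ∑ i ∈ s, f i x := by
  classical
  induction s using Finset.induction_on with
  | empty => simpa using const 0
  | insert a s ha ih =>
    simp only [Finset.sum_insert ha]
    exact (hf a (by simp)).add (ih fun i hi => hf i (by simp [hi]))

theorem pow {f : Euc d → ℂ} (hf : IsExpPoly f) (n : ℕ) : IsExpPoly fun x => f x ^ n := by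
  induction n with
  | zero => simpa using const 1
  | succ n ih => simpa only [pow_succ] using ih.mul hf

theorem continuous {f : Euc d → ℂ} (hf : IsExpPoly f) : Continuous f := by
  obtain ⟨n, p, l, h⟩ := hf
  rw [funext h]
  refine continuous_finsetSum _ fun i _ => Continuous.mul ?_ (by fun_prop)
  exact (MvPolynomial.continuous_eval (p i)).comp (by fun_prop)

end IsExpPoly

/-! ### Continuous one-parameter groups -/

section OneParameter

variable {A : Type*} [NormedRing A] [NormedAlgebra ℝ A] [CompleteSpace A]

/-- The means `c⁻¹ ∫₀ᶜ M` tend to `M 0 = 1`, so one of them is invertible. Since `M t * ∫₀ᶜ M` is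
the integral of `M` from `t` to `t + c`, dividing by it exhibits `M` as differentiable. -/
theorem differentiable_of_continuous_oneParameter {M : ℝ → A} (hM : Continuous M) (h0 : M 0 = 1)
    (hadd : ∀ s t, M (s + t) = M s * M t) : Differentiable ℝ M := by
  have hI : ∀ t, HasDerivAt (fun u => ∫ s in (0 : ℝ)..u, M s) (M t) t := fun t =>
    (hM.integral_hasStrictDerivAt 0 t).hasDerivAt
  have hslope := hasDerivAt_iff_tendsto_slope.1 (hI 0)
  rw [h0] at hslope
  have hunit : ∀ᶠ c in nhdsWithin (0 : ℝ) {0}ᶜ,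
      IsUnit (slope (fun u => ∫ s in (0 : ℝ)..u, M s) 0 c) :=
    hslope.eventually (Units.isOpen.mem_nhds isUnit_one)
  obtain ⟨c, hc⟩ := hunit.exists
  obtain ⟨U, hU⟩ := hc
  have hU' : (U : A) = c⁻¹ • ∫ s in (0 : ℝ)..c, M s := by
    rw [hU, slope_def_module]; simp
  have hrep : M = fun t =>
      (c⁻¹ • ((∫ s in (0 : ℝ)..(t + c), M s) - ∫ s in (0 : ℝ)..t, M s)) * (↑U⁻¹ : A) := by
    funext t
    rw [Units.eq_mul_inv_iff_mul_eq, hU', mul_smul_comm,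
      intervalIntegral.integral_interval_sub_left (hM.intervalIntegrable _ _)
        (hM.intervalIntegrable _ _)]
    congr 1
    have h := (ContinuousLinearMap.mul ℝ A (M t)).intervalIntegral_comp_comm
      (hM.intervalIntegrable (μ := volume) 0 c)
    simp only [ContinuousLinearMap.mul_apply', ← hadd] at h
    rw [← h]
    simp
  rw [hrep]
  intro t
  exact ((((hI (t + c)).comp_add_const t c).sub (hI t)).const_smul c⁻¹ |>.mul_const _).differentiableAt

theorem exists_eq_exp_of_continuous_oneParameter {M : ℝ → A} (hM : Continuous M) (h0 : M 0 = 1)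
    (hadd : ∀ s t, M (s + t) = M s * M t) : ∃ B : A, ∀ t, M t = NormedSpace.exp (t • B) := by
  have hd := differentiable_of_continuous_oneParameter hM h0 hadd
  set B := deriv M 0
  -- The group law gives `M' = M B`, hence `M t * exp(-tB)` is constant.
  have hderiv : ∀ t, HasDerivAt M (M t * B) t := fun t => by
    have h1 : HasDerivAt M B (t - t) := by rw [sub_self]; exact (hd 0).hasDerivAt
    have h2 := (h1.comp_sub_const t t).const_mul (M t)
    refine h2.congr_of_eventuallyEq (Filter.Eventually.of_forall fun s => ?_)
    simp only
    rw [← hadd, add_sub_cancel]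
  have hE : ∀ t : ℝ, HasDerivAt (fun u : ℝ => NormedSpace.exp (u • (-B)))
      ((-B) * NormedSpace.exp (t • (-B))) t := fun t => hasDerivAt_exp_smul_const' (-B) t
  have hprod : ∀ t, HasDerivAt (fun u : ℝ => M u * NormedSpace.exp (u • (-B))) 0 t := fun t => by
    refine ((hderiv t).mul (hE t)).congr_deriv ?_
    noncomm_ring
  refine ⟨B, fun t => ?_⟩
  have hconst := is_const_of_deriv_eq_zero (fun t => (hprod t).differentiableAt)
    (fun t => (hprod t).deriv) t 0
  simp only [h0, zero_smul, NormedSpace.exp_zero, mul_one] at hconst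
  let _ : NormedAlgebra ℚ A := NormedAlgebra.restrictScalars ℚ ℝ A
  have hinv : NormedSpace.exp (t • (-B)) * NormedSpace.exp (t • B) = 1 := by
    rw [← NormedSpace.exp_add_of_commute, smul_neg, neg_add_cancel, NormedSpace.exp_zero]
    rw [smul_neg]
    exact (Commute.refl _).neg_left
  rw [← mul_one (M t), ← hinv, ← mul_assoc, hconst, one_mul]

end OneParameter

/-! ### Matrix coefficients of continuous finite-dimensional representations of `ℝ^d` -/

section Coefficients

variable {V : Type*} [NormedAddCommGroup V] [NormedSpace ℂ V] [FiniteDimensional ℂ V]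

/-- With `N = B - μ`, `exp(tB) = e^{μt} exp(tN)`, and the series of `exp(tN) x` stops before the
term `k`. -/
theorem exp_smul_apply_of_pow_sub_apply_eq_zero (B : V →L[ℂ] V) (μ : ℂ) (k : ℕ)
    (x : V)    (hx : ((B - μ • (1 : V →L[ℂ] V)) ^ k) x = 0) (t : ℝ) :
    NormedSpace.exp (t • B) x = ∑ i ∈ Finset.range k,
      (Complex.exp (μ * t) * ((i.factorial : ℂ)⁻¹ * (t : ℂ) ^ i)) •
        ((B - μ • (1 : V →L[ℂ] V)) ^ i) x := by
  have : CompleteSpace V := FiniteDimensional.complete ℂ V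
  set N := B - μ • (1 : V →L[ℂ] V)
  have hB : t • B = (μ * t) • (1 : V →L[ℂ] V) + (t : ℂ) • N := by
    ext v
    simp [N, smul_sub, smul_smul, mul_comm]
  have hcomm : Commute ((μ * t) • (1 : V →L[ℂ] V)) ((t : ℂ) • N) :=
    (Commute.one_left _).smul_left _
  have hsum : HasSum (fun i : ℕ => ((i.factorial : ℂ)⁻¹ • ((t : ℂ) • N) ^ i) x)
      (NormedSpace.exp ((t : ℂ) • N) x) :=
    (NormedSpace.exp_series_hasSum_exp' (𝕂 := ℂ) ((t : ℂ) • N)).mapL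
      (ContinuousLinearMap.apply ℂ V x)
  have hfin : HasSum (fun i : ℕ => ((i.factorial : ℂ)⁻¹ • ((t : ℂ) • N) ^ i) x)
      (∑ i ∈ Finset.range k, ((i.factorial : ℂ)⁻¹ • ((t : ℂ) • N) ^ i) x) := by
    refine hasSum_sum_of_ne_finset_zero fun i hi => ?_
    obtain ⟨j, rfl⟩ := Nat.exists_eq_add_of_le (not_lt.1 (Finset.mem_range.not.1 hi))
    rw [smul_pow, add_comm k j, pow_add N]
    simp [hx]
  have hexp : NormedSpace.exp ((μ * t) • (1 : V →L[ℂ] V)) = Complex.exp (μ * t) • 1 := by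
    rw [← Algebra.algebraMap_eq_smul_one, ← Algebra.algebraMap_eq_smul_one,
      ← NormedSpace.algebraMap_exp_comm, Complex.exp_eq_exp_ℂ]
  let _ : NormedAlgebra ℚ (V →L[ℂ] V) := NormedAlgebra.restrictScalars ℚ ℂ _
  rw [hB, NormedSpace.exp_add_of_commute hcomm, hexp, smul_mul_assoc, one_mul,
    smul_apply, hsum.unique hfin, Finset.smul_sum]
  refine Finset.sum_congr rfl fun i _ => ?_
  simp only [smul_pow, smul_apply, smul_smul]

variable {d : ℕ}

/-- All matrix coefficients of the operator-valued function `F` are exponential polynomials. -/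
def HasExpPolyCoeffs (F : Euc d → V →L[ℂ] V) : Prop :=
  ∀ (x : V) (f : Module.Dual ℂ V), IsExpPoly fun y => f (F y x)

theorem HasExpPolyCoeffs.mul {F G : Euc d → V →L[ℂ] V} (hF : HasExpPolyCoeffs F)
    (hG : HasExpPolyCoeffs G) : HasExpPolyCoeffs fun y => F y * G y := by
  intro x f
  let b := Module.finBasis ℂ V
  have h : ∀ y, f ((F y * G y) x) = ∑ i, b.coord i (G y x) * f (F y (b i)) := fun y => by
    rw [mul_apply_eq_comp]
    conv_lhs => rw [← b.sum_repr (G y x)]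
    simp only [map_sum, map_smul, smul_eq_mul, Module.Basis.coord_apply]
  simp_rw [h]
  exact IsExpPoly.sum _ fun i _ => (hG x (b.coord i)).mul (hF (b i) f)

theorem hasExpPolyCoeffs_exp_coord (B : V →L[ℂ] V) (j : Fin d) :
    HasExpPolyCoeffs fun y : Euc d => NormedSpace.exp (y j • B) := by
  intro x f
  -- Over `ℂ` the generalized eigenspaces span, so it is enough to treat a generalized eigenvector.
  have hx : x ∈ ⨆ μ : ℂ, Module.End.maxGenEigenspace (B : V →ₗ[ℂ] V) μ := by
    rw [Module.End.iSup_maxGenEigenspace_eq_top]; trivial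
  induction hx using Submodule.iSup_induction' with
  | mem μ x hx =>
    obtain ⟨k, hk⟩ := (Module.End.mem_maxGenEigenspace _ _ _).1 hx
    have hk' : ((B - μ • (1 : V →L[ℂ] V)) ^ k) x = 0 := by
      rw [← hk, ← ContinuousLinearMap.coe_coe, ContinuousLinearMap.toLinearMap_pow]
      rfl
    simp_rw [exp_smul_apply_of_pow_sub_apply_eq_zero B μ k x hk', map_sum, map_smul, smul_eq_mul]
    exact IsExpPoly.sum _ fun i _ => ((IsExpPoly.exp_coord μ j).mul
      ((IsExpPoly.const _).mul ((IsExpPoly.coord j).pow i))).mul (IsExpPoly.const _)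
  | zero => simpa using IsExpPoly.const 0
  | add x x' _ _ h h' => simpa using h.add h'

/-- Writing `y = ∑ y_j e_j` factors `M y` into one-parameter groups, each an exponential. -/
theorem hasExpPolyCoeffs_of_continuous {M : Euc d → V →L[ℂ] V} (hM : Continuous M) (h0 : M 0 = 1)
    (hadd : ∀ a b, M (a + b) = M a * M b) : HasExpPolyCoeffs M := by
  have : CompleteSpace V := FiniteDimensional.complete ℂ V
  have hs : ∀ s : Finset (Fin d), HasExpPolyCoeffs fun y : Euc d =>
      M (∑ j ∈ s, y j • EuclideanSpace.basisFun (Fin d) ℝ j) := by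
    intro s
    induction s using Finset.induction_on with
    | empty =>
      intro x f
      simpa [h0] using IsExpPoly.const (f x)
    | insert a s ha ih =>
      simp_rw [Finset.sum_insert ha, hadd]
      refine HasExpPolyCoeffs.mul ?_ ih
      obtain ⟨B, hB⟩ := exists_eq_exp_of_continuous_oneParameter
        (M := fun t : ℝ => M (t • EuclideanSpace.basisFun (Fin d) ℝ a))
        (hM.comp (by fun_prop)) (by simp [h0]) (fun s t => by rw [add_smul, hadd])
      simp_rw [hB]
      exact hasExpPolyCoeffs_exp_coord B a
  have h := hs Finset.univ
  have hy : ∀ y : Euc d, ∑ j, y j • EuclideanSpace.basisFun (Fin d) ℝ j = y := fun y => by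
    simpa using (EuclideanSpace.basisFun (Fin d) ℝ).sum_repr y
  simpa only [hy] using h

end Coefficients

namespace IsWeaklyContinuousRep

variable {d : ℕ} {X I : Type*} [AddCommGroup X] [Module ℂ X] {τ : Euc d → Module.End ℂ X}
  {L : I → Module.Dual ℂ X}

theorem isExpPoly_coeff (hτ : IsWeaklyContinuousRep τ L) (Z : Submodule ℂ X)
    [FiniteDimensional ℂ Z] (hZ : ∀ y, Z.map (τ y) ≤ Z) (f : Module.Dual ℂ X) {x : X}
    (hx : x ∈ Z) : IsExpPoly fun y => f (τ y x) := by
  -- `X` carries no topology here; coordinates move the action to the normed space `ℂ^n`, where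
  -- continuity is checked entrywise.
  let e := (Module.finBasis ℂ Z).equivFun
  have hmem : ∀ y, ∀ z ∈ Z, τ y z ∈ Z := fun y z hz => hZ y (Submodule.mem_map_of_mem hz)
  let ρ : Euc d → Module.End ℂ Z := fun y => (τ y).restrict (hmem y)
  let M : Euc d → (Fin (Module.finrank ℂ Z) → ℂ) →L[ℂ] (Fin (Module.finrank ℂ Z) → ℂ) :=
    fun y => LinearMap.toContinuousLinearMap (e.toLinearMap ∘ₗ ρ y ∘ₗ e.symm.toLinearMap)
  have hM : HasExpPolyCoeffs M := by
    refine hasExpPolyCoeffs_of_continuous (continuous_clm_apply.2 fun v => ?_) ?_ fun a b => ?_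
    · refine continuous_pi fun i => ?_
      obtain ⟨g, hg, hgc⟩ := hτ.exists_extend_continuous Z
        (LinearMap.proj i ∘ₗ e.toLinearMap)
      convert hgc (e.symm v) using 2 with y
      exact (hg (ρ y (e.symm v))).symm
    · ext1 v
      have : ρ 0 = 1 := by
        ext z; simp [ρ, hτ.zero]
      simp [M, this]
    · ext1 v
      have : ρ (a + b) = ρ a * ρ b := by
        ext z; simp [ρ, hτ.add]
      simp [M, this]
  convert hM (e ⟨x, hx⟩) (f ∘ₗ Z.subtype ∘ₗ e.symm.toLinearMap) using 2 with y
  simp [M, ρ]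

end IsWeaklyContinuousRep

/-! ### Integrals of families of test functions -/

section TestFunctionIntegral

variable {X : Type*} [AddCommGroup X] [Module ℝ X] [TopologicalSpace X] {B : ℕ → Type*}
  [∀ i, NormedAddCommGroup (B i)] [∀ i, NormedSpace ℝ (B i)]

/-- A continuous functional on a space whose topology is induced by maps into normed spaces factors
through finitely many of these. -/
theorem exists_factor_of_withSeminorms {J : ∀ i, X →L[ℝ] B i}
    (hJ : WithSeminorms fun i => (normSeminorm ℝ (B i)).comp (J i).toLinearMap) (u : X →L[ℝ] ℝ) :
    ∃ (s : Finset ℕ) (g : (∀ i : s, B i) →L[ℝ] ℝ), ∀ f, u f = g fun i => J i f := by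
  -- Finitely many seminorms bound `u`, so `u` descends to the range of `R` and extends from there
  -- by Hahn–Banach.
  obtain ⟨s, C, -, hC⟩ := Seminorm.bound_of_continuous hJ
    ((normSeminorm ℝ ℝ).comp u.toLinearMap) (continuous_norm.comp u.continuous)
  let R : X →ₗ[ℝ] ∀ i : s, B i := LinearMap.pi fun i => (J i).toLinearMap
  have hbound : ∀ f, ‖u f‖ ≤ C * ‖R f‖ := fun f => by
    refine (hC f).trans ?_
    rw [smul_apply, NNReal.smul_def, smul_eq_mul]
    refine mul_le_mul_of_nonneg_left ?_ C.2
    exact Seminorm.finset_sup_apply_le (norm_nonneg _) fun i hi => norm_le_pi_norm (R f) ⟨i, hi⟩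
  have hker : LinearMap.ker R ≤ LinearMap.ker u.toLinearMap := fun f hf => by
    have h := hbound f
    rw [LinearMap.mem_ker.1 hf, norm_zero, mul_zero] at h
    exact norm_le_zero_iff.1 h
  let w : Module.Dual ℝ (LinearMap.range R) :=
    (LinearMap.ker R).liftQ u.toLinearMap hker ∘ₗ R.quotKerEquivRange.symm.toLinearMap
  have hw : ∀ f, w ⟨R f, f, rfl⟩ = u f := fun f => by
    have : R.quotKerEquivRange.symm ⟨R f, f, rfl⟩ = (LinearMap.ker R).mkQ f := by
      rw [LinearEquiv.symm_apply_eq]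
      rfl
    simp [w, this]
  have hwb : ∀ v, ‖w v‖ ≤ (C • normSeminorm ℝ (∀ i : s, B i)) v := by
    rintro ⟨_, f, rfl⟩
    rw [hw]
    exact hbound f
  have hcont : Continuous (C • normSeminorm ℝ (∀ i : s, B i)) :=
    (continuous_norm (E := ∀ i : s, B i)).const_smul C
  obtain ⟨g, hg, -⟩ := Module.Dual.exists_continuous_extension_of_le_seminorm (LinearMap.range R) w
    hcont hwb
  exact ⟨s, g, fun f => (hw f).symm.trans (hg ⟨R f, f, rfl⟩).symm⟩

/-- Continuous functionals commute with weak integrals that are determined by a separating family of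
functionals on the normed spaces inducing the topology. -/
theorem map_eq_integral_of_withSeminorms {E : Type*} [TopologicalSpace E] [MeasurableSpace E]
    [OpensMeasurableSpace E] {μ : Measure E} [IsFiniteMeasureOnCompacts μ]
    [∀ i, CompleteSpace (B i)] {J : ∀ i, X →L[ℝ] B i}
    (hJ : WithSeminorms fun i => (normSeminorm ℝ (B i)).comp (J i).toLinearMap) {κ : Type*}
    {W : ℕ → Type*} [∀ i, NormedAddCommGroup (W i)] [∀ i, NormedSpace ℝ (W i)]
    [∀ i, CompleteSpace (W i)] (e : ∀ i, κ → B i →L[ℝ] W i)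
    (he : ∀ i (b b' : B i), (∀ k, e i k b = e i k b') → b = b') {F : E → X} (hF : Continuous F)
    (hFc : HasCompactSupport F) {f : X}
    (hf : ∀ i k, e i k (J i f) = ∫ z, e i k (J i (F z)) ∂μ) (u : X →L[ℝ] ℂ) :
    u f = ∫ z, u (F z) ∂μ := by
  -- The integral of `R ∘ F` is a Bochner integral in a finite product of Banach spaces, through
  -- which `v` factors; no integral in `X` itself is needed.
  have key : ∀ v : X →L[ℝ] ℝ, v f = ∫ z, v (F z) ∂μ := fun v => by
    obtain ⟨s, g, hg⟩ := exists_factor_of_withSeminorms hJ v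
    let R : X →L[ℝ] ∀ i : s, B i := ContinuousLinearMap.pi fun i => J i
    have hint : Integrable (fun z => R (F z)) μ :=
      (R.continuous.comp hF).integrable_of_hasCompactSupport (hFc.comp_left (map_zero R))
    have hR : R f = ∫ z, R (F z) ∂μ := by
      funext i
      refine he i _ _ fun k => (hf i k).trans ?_
      exact ((e i k).comp (ContinuousLinearMap.proj (R := ℝ)
        (φ := fun i : s => B i) i)).integral_comp_comm hint
    rw [hg f]
    simp_rw [hg]
    exact (congrArg g hR).trans (g.integral_comp_comm hint).symm
  have hint : Integrable (fun z => u (F z)) μ :=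
    (u.continuous.comp hF).integrable_of_hasCompactSupport (hFc.comp_left (map_zero u))
  apply Complex.ext
  · exact (key (Complex.reCLM.comp u)).trans (Complex.reCLM.integral_comp_comm hint)
  · exact (key (Complex.imCLM.comp u)).trans (Complex.imCLM.integral_comp_comm hint)

open scoped BoundedContinuousFunction

theorem continuous_boundedContinuousFunction_of_hasCompactSupport {E E' V : Type*}
    [PseudoMetricSpace E] [PseudoMetricSpace E'] [NormedAddCommGroup V] {G : E → E' → V}
    (hG : Continuous (Function.uncurry G))
    (hGc : HasCompactSupport (Function.uncurry G)) {F : E → E' →ᵇ V} (hF : ∀ z x, F z x = G z x) :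
    Continuous F := by
  have hu : UniformContinuous (Function.uncurry G) := hGc.uniformContinuous_of_continuous hG
  refine Metric.continuous_iff.2 fun z ε hε => ?_
  obtain ⟨δ, hδ, h⟩ := Metric.uniformContinuous_iff.1 hu (ε / 2) (half_pos hε)
  refine ⟨δ, hδ, fun z' hz => lt_of_le_of_lt
    ((BoundedContinuousFunction.dist_le (half_pos hε).le).2 fun x => ?_) (half_lt_self hε)⟩
  rw [hF, hF]
  exact (h (a := (z', x)) (b := (z, x)) (by simpa [Prod.dist_eq, hδ] using hz)).le

variable {E : Type*} [NormedAddCommGroup E] [NormedSpace ℝ E] [MeasurableSpace E] [BorelSpace E]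

theorem map_eq_integral_of_iteratedFDeriv_eq {μ : Measure E} [IsFiniteMeasureOnCompacts μ]
    {K : Compacts E} {F : E → ContDiffMapSupportedIn E ℝ ⊤ K} (hF : Continuous F)
    (hFc : HasCompactSupport F) {f : ContDiffMapSupportedIn E ℝ ⊤ K}
    (hf : ∀ i x, iteratedFDeriv ℝ i f x = ∫ z, iteratedFDeriv ℝ i (F z) x ∂μ)
    (u : ContDiffMapSupportedIn E ℝ ⊤ K →L[ℝ] ℂ) : u f = ∫ z, u (F z) ∂μ := by
  have hJ : WithSeminorms fun i => (normSeminorm ℝ (E →ᵇ (E [×i]→L[ℝ] ℝ))).comp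
      (ContDiffMapSupportedIn.structureMapCLM ℝ ⊤ i :
        ContDiffMapSupportedIn E ℝ ⊤ K →L[ℝ] _).toLinearMap :=
    ContDiffMapSupportedIn.withSeminorms ℝ E ℝ ⊤ K
  refine map_eq_integral_of_withSeminorms (B := fun i => E →ᵇ (E [×i]→L[ℝ] ℝ))
    (W := fun i => E [×i]→L[ℝ] ℝ) hJ
    (fun i x => BoundedContinuousFunction.evalCLM ℝ x)
    (fun i b b' h => BoundedContinuousFunction.ext h) hF hFc (fun i x => ?_) u
  simpa [ContDiffMapSupportedIn.structureMapCLM_top_apply] using hf i x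

open scoped ContDiff in
theorem iteratedFDeriv_integral_mul_comp_sub {μ : Measure E} [SFinite μ]
    [μ.IsAddLeftInvariant]
    {φ ψ : E → ℝ} (hφ : LocallyIntegrable φ μ) (hψ : ContDiff ℝ ∞ ψ)
    (hψc : HasCompactSupport ψ) (i : ℕ) (x : E) :
    iteratedFDeriv ℝ i (fun x => ∫ z, φ z • ψ (x - z) ∂μ) x =
      ∫ z, φ z • iteratedFDeriv ℝ i ψ (x - z) ∂μ := by
  induction i generalizing x with
  | zero =>
    simp only [iteratedFDeriv_zero_eq_comp, Function.comp_apply]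
    rw [← LinearIsometryEquiv.coe_toContinuousLinearEquiv, ← ContinuousLinearEquiv.integral_comp_comm]
    simp only [map_smul]
  | succ i ih =>
    have hcont : ContDiff ℝ 1 (iteratedFDeriv ℝ i ψ) :=
      hψ.iteratedFDeriv_right (by exact_mod_cast le_top)
    have h := (hψc.iteratedFDeriv (𝕜 := ℝ) i).hasFDerivAt_convolution_right
      (ContinuousLinearMap.lsmul ℝ ℝ) (μ := μ) hφ hcont x
    rw [iteratedFDeriv_succ_eq_comp_left, Function.comp_apply, funext ih]
    have h2 : fderiv ℝ (fun x => ∫ z, φ z • iteratedFDeriv ℝ i ψ (x - z) ∂μ) x =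
      ∫ z, φ z • fderiv ℝ (iteratedFDeriv ℝ i ψ) (x - z) ∂μ := h.fderiv
    rw [h2]
    refine (ContinuousLinearEquiv.integral_comp_comm (𝕜 := ℝ) (μ := μ) (E := E →L[ℝ] E [×i]→L[ℝ] ℝ)
      (F := E [×(i + 1)]→L[ℝ] ℝ) (continuousMultilinearCurryLeftEquiv ℝ (fun _ : Fin (i + 1) => E)
      ℝ).symm.toContinuousLinearEquiv
        fun z => φ z • fderiv ℝ (iteratedFDeriv ℝ i ψ) (x - z)).symm.trans ?_
    simp only [map_smul]
    rfl

end TestFunctionIntegral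

/-! ### Distributions and translates of test functions -/

section Translates

open scoped Pointwise ContDiff

variable {d : ℕ}

/-- The sum of the supports of `φ` and `ψ`. -/
def sumSupport {φ : Euc d → ℝ} (hφ : HasCompactSupport φ) (ψ : TestFun d) : Compacts (Euc d) :=
  ⟨tsupport φ + tsupport ψ, hφ.isCompact.add ψ.hasCompactSupport.isCompact⟩

/-- The family `z ↦ φ(z) τ_{-z} ψ` of smooth functions supported in the sum of the supports. -/
def mulTranslate {φ : Euc d → ℝ} (hφ : HasCompactSupport φ) (ψ : TestFun d) (z : Euc d) :
    ContDiffMapSupportedIn (Euc d) ℝ ⊤ (sumSupport hφ ψ) where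
  toFun x := φ z • ψ (x - z)
  contDiff' := ContDiff.smul (f := fun _ => φ z) contDiff_const
    (ψ.contDiff.comp (contDiff_id.sub contDiff_const))
  zero_on_compl' x hx := by
    by_contra h
    refine hx ⟨z, subset_tsupport _ (left_ne_zero_of_smul h), x - z,
      subset_tsupport _ (right_ne_zero_of_smul h), by simp⟩

/-- The inclusion of the smooth functions supported in `K` into the test functions. -/
def inclTest (K : Compacts (Euc d)) : ContDiffMapSupportedIn (Euc d) ℝ ⊤ K →L[ℝ] TestFun d :=
  TestFunction.ofSupportedInCLM ℝ (Set.subset_univ _)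

theorem inclTest_apply {K : Compacts (Euc d)} (f : ContDiffMapSupportedIn (Euc d) ℝ ⊤ K)
    (x : Euc d) : inclTest K f x = f x := rfl

variable {φ : Euc d → ℝ} (hφ : HasCompactSupport φ) (ψ : TestFun d)

theorem mulTranslate_apply (z x : Euc d) : mulTranslate hφ ψ z x = φ z • ψ (x - z) := rfl

theorem inclTest_mulTranslate (z : Euc d) :
    inclTest _ (mulTranslate hφ ψ z) = φ z • translateTest (-z) ψ := by
  ext x
  simp [translateTest_apply, sub_eq_add_neg, mulTranslate_apply, inclTest_apply]

/-- The restriction of a distribution to the smooth functions supported in `K`. -/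
def restrictDistr (T : Distr d) (K : Compacts (Euc d)) :
    ContDiffMapSupportedIn (Euc d) ℝ ⊤ K →L[ℝ] ℂ :=
  ContinuousLinearMap.comp (M₂ := TestFun d) T (inclTest K)

theorem restrictDistr_mulTranslate (T : Distr d) (z : Euc d) :
    restrictDistr T _ (mulTranslate hφ ψ z) = φ z • T (translateTest (-z) ψ) :=
  (congrArg T (inclTest_mulTranslate hφ ψ z)).trans (map_smul T _ _)

theorem iteratedFDeriv_mulTranslate (i : ℕ) (z x : Euc d) :
    iteratedFDeriv ℝ i (mulTranslate hφ ψ z) x = φ z • iteratedFDeriv ℝ i ψ (x - z) := by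
  have h : ContDiffAt ℝ i (fun x => ψ (x - z)) x :=
    (ContDiff.of_le (n := ∞) (ψ.contDiff.comp (contDiff_id.sub contDiff_const))
      (by exact_mod_cast le_top)).contDiffAt
  rw [← iteratedFDeriv_comp_sub (f := ψ) i z x]
  exact iteratedFDeriv_const_smul_apply' h

theorem hasCompactSupport_mulTranslate : HasCompactSupport (mulTranslate hφ ψ) := by
  refine hφ.mono fun z hz => ?_
  contrapose! hz
  rw [Function.notMem_support] at hz ⊢
  ext x
  simp [mulTranslate_apply, hz]

theorem continuous_mulTranslate (hφc : Continuous φ) : Continuous (mulTranslate hφ ψ) := by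
  refine (ContDiffMapSupportedIn.continuous_iff_comp _).2 fun i => ?_
  have hψ : Continuous (iteratedFDeriv ℝ i ψ) :=
    ψ.contDiff.continuous_iteratedFDeriv (by exact_mod_cast le_top)
  refine continuous_boundedContinuousFunction_of_hasCompactSupport
    (G := fun z x => φ z • iteratedFDeriv ℝ i ψ (x - z)) ?_ ?_ fun z x => ?_
  · exact (hφc.comp continuous_fst).smul (hψ.comp (continuous_snd.sub continuous_fst))
  · have hK : IsCompact ((fun p : Euc d × Euc d => (p.1, p.2 + p.1)) ''
        (tsupport φ ×ˢ tsupport (iteratedFDeriv ℝ i ψ))) :=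
      (hφ.isCompact.prod (ψ.hasCompactSupport.iteratedFDeriv i).isCompact).image (by fun_prop)
    refine HasCompactSupport.intro hK fun p hp => ?_
    by_contra h
    exact hp ⟨(p.1, p.2 - p.1), ⟨subset_tsupport _ (left_ne_zero_of_smul h),
      subset_tsupport _ (right_ne_zero_of_smul h)⟩, by simp⟩
  · rw [Function.comp_apply, ContDiffMapSupportedIn.structureMapCLM_top_apply]
    exact iteratedFDeriv_mulTranslate hφ ψ i z x

theorem continuous_apply_translateTest (T : Distr d) (ψ : TestFun d) :
    Continuous fun y => T (translateTest y ψ) := by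
  suffices h : Continuous fun y => T (translateTest (-y) ψ) by
    exact (h.comp continuous_neg).congr fun y => by simp
  refine continuous_iff_continuousAt.2 fun y => ?_
  -- Multiplying by a bump equal to `1` near `y` confines all translates to one compact set, without
  -- changing the function near `y`.
  let φ : ContDiffBump y := default
  have hc : Continuous fun z => φ z • T (translateTest (-z) ψ) := by
    have h := (restrictDistr T _).continuous.comp
      (continuous_mulTranslate φ.hasCompactSupport ψ φ.continuous)
    refine h.congr fun z => ?_
    exact restrictDistr_mulTranslate _ ψ T z
  refine hc.continuousAt.congr ?_
  filter_upwards [φ.eventuallyEq_one] with z hz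
  simp [hz]

/-- The convolution of two test functions. -/
def convTest (φ ψ : TestFun d) : TestFun d where
  toFun := convolution φ ψ (ContinuousLinearMap.lsmul ℝ ℝ) volume
  contDiff' := ψ.hasCompactSupport.contDiff_convolution_right _
    φ.continuous.locallyIntegrable ψ.contDiff
  hasCompactSupport' := φ.hasCompactSupport.convolution _ ψ.hasCompactSupport
  tsupport_subset' _ _ := trivial

theorem convTest_apply (φ ψ : TestFun d) (x : Euc d) :
    convTest φ ψ x = ∫ z, φ z • ψ (x - z) := rfl

theorem convTest_comm (φ ψ : TestFun d) : convTest φ ψ = convTest ψ φ := by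
  ext x
  refine (convolution_lsmul_swap (μ := volume) (𝕜 := ℝ) (f := φ) (g := ψ) (x := x)).trans ?_
  simp [convTest_apply, mul_comm]

/-- A distribution commutes with the integral defining a convolution. -/
theorem apply_convTest (T : Distr d) (φ ψ : TestFun d) :
    T (convTest φ ψ) = ∫ z, (φ z : ℂ) * T (translateTest (-z) ψ) := by
  -- The convolution is viewed in the space of functions supported in one compact set, where weak
  -- integrals can be tested derivative by derivative.
  let f : ContDiffMapSupportedIn (Euc d) ℝ ⊤ (sumSupport φ.hasCompactSupport ψ) :=
    { toFun := convTest φ ψ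
      contDiff' := (convTest φ ψ).contDiff
      zero_on_compl' := fun x hx => by
        rw [convTest_apply]
        refine integral_eq_zero_of_ae (Filter.Eventually.of_forall fun z => ?_)
        change mulTranslate φ.hasCompactSupport ψ z x = 0
        exact (mulTranslate φ.hasCompactSupport ψ z).zero_on_compl hx }
  have h := map_eq_integral_of_iteratedFDeriv_eq (μ := volume)
    (continuous_mulTranslate φ.hasCompactSupport ψ φ.continuous)
    (hasCompactSupport_mulTranslate φ.hasCompactSupport ψ) (f := f) (fun i x => by
      simp_rw [iteratedFDeriv_mulTranslate]
      exact iteratedFDeriv_integral_mul_comp_sub φ.continuous.locallyIntegrable ψ.contDiff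
        ψ.hasCompactSupport i x)
    (restrictDistr T _)
  refine Eq.trans ?_ (h.trans (integral_congr_ae (Filter.Eventually.of_forall fun z => ?_)))
  · rfl
  · exact (restrictDistr_mulTranslate _ ψ T z).trans (Complex.real_smul ..)

end Translates

/-! ### The translation representations -/

/-- Evaluation of continuous functions at a point. -/
def evalFun {d : ℕ} (p : Euc d) : Module.Dual ℂ C(Euc d, ℂ) where
  toFun f := f p
  map_add' _ _ := rfl
  map_smul' _ _ := rfl

/-- Evaluation of distributions at a test function. -/
def evalDistr {d : ℕ} (φ : TestFun d) : Module.Dual ℂ (Distr d) where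
  toFun T := T φ
  map_add' _ _ := rfl
  map_smul' _ _ := rfl

theorem evalDistr_apply {d : ℕ} (φ : TestFun d) (T : Distr d) : evalDistr φ T = T φ := rfl

theorem isWeaklyContinuousRep_translateFun (d : ℕ) :
    IsWeaklyContinuousRep (translateFun (d := d)) (evalFun (d := d)) where
  zero := by
    ext f x
    simp [translateFun]
  add a b := by
    ext f x
    simp [translateFun, add_assoc]
  separating f hf := ContinuousMap.ext hf
  continuous p f := by
    change Continuous fun y => f (p + y)
    fun_prop

theorem isWeaklyContinuousRep_translateDistr (d : ℕ) :
    IsWeaklyContinuousRep (translateDistr (d := d)) (evalDistr (d := d)) where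
  zero := by
    ext T φ
    change T (translateTest (-0) φ) = T φ
    congr 1
    ext x
    simp [translateTest_apply]
  add a b := by
    ext T φ
    change T (translateTest (-(a + b)) φ) = T (translateTest (-b) (translateTest (-a) φ))
    congr 1
    ext x
    simp only [translateTest_apply]
    congr 1
    abel
  separating T hT := by
    ext φ
    exact hT φ
  continuous φ T := (continuous_apply_translateTest T φ).comp continuous_neg

theorem diffFun_eq {d : ℕ} (h : Euc d) (m : ℕ) : diffFun h m = (translateFun h - 1) ^ m :=
  (isWeaklyContinuousRep_translateFun d).sum_choose_smul h m

theorem translateDistr_apply {d : ℕ} (y : Euc d) (T : Distr d) (φ : TestFun d) :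
    translateDistr y T φ = T (translateTest (-y) φ) := rfl

theorem diffDistr_eq {d : ℕ} (h : Euc d) (m : ℕ) : diffDistr h m = (translateDistr h - 1) ^ m := by
  rw [← (isWeaklyContinuousRep_translateDistr d).sum_choose_smul h m]
  ext T φ
  change T (diffTest (-h) m φ) = evalDistr φ _
  rw [diffTest, _root_.sum_apply, map_sum, LinearMap.sum_apply, map_sum]
  refine Finset.sum_congr rfl fun k _ => ?_
  rw [smul_apply, map_smul, LinearMap.smul_apply, map_smul, evalDistr_apply,
    translateDistr_apply, smul_neg, Complex.real_smul, smul_eq_mul]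
  push_cast
  rfl

/-! ### Translation-invariant spaces of distributions -/

/-- The exponential polynomials in a subspace of distributions. -/
def expPolySubmodule {d : ℕ} (Z : Submodule ℂ (Distr d)) : Submodule ℂ Z where
  carrier := {T | IsExpPolyDistr (T : Distr d)}
  zero_mem' := ⟨fun _ => 0, IsExpPoly.const 0, fun φ => by simp⟩
  add_mem' := by
    rintro S T ⟨f, hf, hS⟩ ⟨g, hg, hT⟩
    refine ⟨_, hf.add hg, fun φ => ?_⟩
    have hint : ∀ {f : Euc d → ℂ}, IsExpPoly f → Integrable fun x => (φ x : ℂ) * f x := fun hf =>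
      ((Complex.continuous_ofReal.comp φ.continuous).mul hf.continuous).integrable_of_hasCompactSupport
        ((φ.hasCompactSupport.comp_left Complex.ofReal_zero).mul_right)
    simp_rw [mul_add]
    rw [integral_add (hint hf) (hint hg), ← hS, ← hT]
    rfl
  smul_mem' := by
    rintro c T ⟨f, hf, hT⟩
    refine ⟨_, (IsExpPoly.const c).mul hf, fun φ => ?_⟩
    simp_rw [mul_left_comm _ c]
    rw [integral_const_mul, ← hT]
    rfl

theorem isExpPolyDistr_of_mem {d : ℕ} (Z : Submodule ℂ (Distr d)) [FiniteDimensional ℂ Z]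
    (hZ : ∀ y, Z.map (translateDistr y) ≤ Z) {T : Distr d} (hT : T ∈ Z) : IsExpPolyDistr T := by
  have hτ := isWeaklyContinuousRep_translateDistr d
  have hmem : ∀ y, translateDistr y T ∈ Z := fun y => hZ y (Submodule.mem_map_of_mem hT)
  let o : Euc d → Z := fun y => ⟨translateDistr y T, hmem y⟩
  have ho : ∀ f : Module.Dual ℂ Z, Continuous fun y => f (o y) := fun f => by
    obtain ⟨g, hg, hgc⟩ := hτ.exists_extend_continuous Z f
    exact (hgc T).congr fun y => hg (o y)
  have hint : ∀ (ψ : TestFun d) (f : Module.Dual ℂ Z), Integrable fun z => (ψ z : ℂ) * f (o z) :=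
    fun ψ f => ((Complex.continuous_ofReal.comp ψ.continuous).mul
      (ho f)).integrable_of_hasCompactSupport
        ((ψ.hasCompactSupport.comp_left Complex.ofReal_zero).mul_right)
  let b := Module.finBasis ℂ Z
  -- `S ψ` is the average `∫ ψ(z) τ_z T dz`, defined by its coordinates in `Z`.
  let S : TestFun d → Z := fun ψ => ∑ k, (∫ z, (ψ z : ℂ) * b.coord k (o z)) • b k
  have hS : ∀ (ψ : TestFun d) (f : Module.Dual ℂ Z), f (S ψ) = ∫ z, (ψ z : ℂ) * f (o z) := by
    intro ψ f
    have h : ∀ z, (ψ z : ℂ) * f (o z) = ∑ k, ((ψ z : ℂ) * b.coord k (o z)) * f (b k) := fun z => by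
      conv_lhs => rw [← b.sum_repr (o z), map_sum, Finset.mul_sum]
      simp [mul_assoc]
    simp_rw [h]
    rw [integral_finsetSum _ fun k _ => (hint ψ _).mul_const _]
    simp [S, integral_mul_const]
  have hSmem : ∀ ψ, S ψ ∈ expPolySubmodule Z := fun ψ => by
    refine ⟨fun z => T (translateTest (-z) ψ), ?_, fun φ => ?_⟩
    · exact hτ.isExpPoly_coeff Z hZ (evalDistr ψ) hT
    -- Commutativity of convolution exchanges `φ` and `ψ`, turning integration of `φ` against `z ↦
    -- T(τ_{-z} ψ)` into `S ψ` evaluated at `φ`.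
    · rw [← apply_convTest, convTest_comm, apply_convTest]
      exact hS ψ ((evalDistr φ).domRestrict Z)
  suffices h : (⟨T, hT⟩ : Z) ∈ expPolySubmodule Z from h
  by_contra hT'
  obtain ⟨f, hf, hfZ⟩ := Submodule.exists_le_ker_of_notMem hT'
  -- `f` kills every `S ψ`, so the continuous function `z ↦ f (τ_z T)` integrates to zero against
  -- all test functions and vanishes, in particular at `z = 0`.
  have hae : ∀ᵐ z, f (o z) = 0 :=
    ae_eq_zero_of_integral_contDiff_smul_eq_zero (ho f).locallyIntegrable fun g hg hgc => by
      have h : f (S ⟨g, hg, hgc, fun _ _ => trivial⟩) = 0 := hfZ (hSmem _)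
      rw [hS] at h
      exact h
  have hzero : (fun z => f (o z)) = fun _ => 0 :=
    ((ho f).ae_eq_iff_eq volume continuous_const).1 hae
  refine hf ?_
  have h0 : o 0 = ⟨T, hT⟩ := Subtype.ext (by simp [o, hτ.zero])
  rw [← h0]
  exact congrFun hzero 0

end

/-! ### The theorem for continuous functions and for distributions -/

theorem mainTheorem2 (d t : ℕ) (h : Fin t → Euc d) (m : Fin t → ℕ) (hm : ∀ k, 0 < m k)
    (hdense : Dense (AddSubgroup.closure (Set.range h) : Set (Euc d))) :
    (∀ W H : Submodule ℂ C(Euc d, ℂ),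
      FiniteDimensional ℂ W → FiniteDimensional ℂ H →
      (∀ k, W.map (diffFun (h k) (m k)) ≤ H) →
      (∀ k, H.map (diffFun (h k) (m k)) ≤ H) →
      (∃ Z : Submodule ℂ C(Euc d, ℂ), FiniteDimensional ℂ Z ∧
        (∀ y : Euc d, Z.map (translateFun y) ≤ Z) ∧
        (W : Set C(Euc d, ℂ)) ∪ (H : Set C(Euc d, ℂ)) ⊆ (Z : Set C(Euc d, ℂ))) ∧
      ∀ f ∈ (W : Set C(Euc d, ℂ)) ∪ (H : Set C(Euc d, ℂ)), IsExpPoly f) ∧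
    (∀ W H : Submodule ℂ (Distr d),
      FiniteDimensional ℂ W → FiniteDimensional ℂ H →
      (∀ k, W.map (diffDistr (h k) (m k)) ≤ H) →
      (∀ k, H.map (diffDistr (h k) (m k)) ≤ H) →
      (∃ Z : Submodule ℂ (Distr d), FiniteDimensional ℂ Z ∧
        (∀ y : Euc d, Z.map (translateDistr y) ≤ Z) ∧
        (W : Set (Distr d)) ∪ (H : Set (Distr d)) ⊆ (Z : Set (Distr d))) ∧
      ∀ T ∈ (W : Set (Distr d)) ∪ (H : Set (Distr d)), IsExpPolyDistr T) := by
  constructor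
  · intro W H _ _ hW hH
    simp only [diffFun_eq] at hW hH
    have hτ := isWeaklyContinuousRep_translateFun d
    obtain ⟨Z, hZ, hinv, hsub⟩ := hτ.exists_invariant h m hm hdense W H hW hH
    refine ⟨⟨Z, hZ, hinv, hsub⟩, fun f hf => ?_⟩
    -- `f y` is the value of `τ_y f` at `0`, a matrix coefficient of the action on `Z`.
    simpa [translateFun, evalFun] using hτ.isExpPoly_coeff Z hinv (evalFun 0) (hsub hf)
  · intro W H _ _ hW hH
    simp only [diffDistr_eq] at hW hH
    obtain ⟨Z, hZ, hinv, hsub⟩ := (isWeaklyContinuousRep_translateDistr d).exists_invariant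
      h m hm hdense W H hW hH
    exact ⟨⟨Z, hZ, hinv, hsub⟩, fun T hT => isExpPolyDistr_of_mem Z hinv (hsub hT)⟩
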